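/- Consider a control-affine system $\dot x=f(x)+g(x)u$, $x=(x_1,x_2,x_c)\in\mathbb R^{n_1}\times\mathbb R^{n_2}\times\mathbb R^{n_c}$, $u=(u_1,u_2,u_c)\in\mathcal U\subset\mathbb R^{m_1}\times\mathbb R^{m_2}\times\mathbb R^{m_c}$, and write $P_i x=(x_i,x_c)$, $P_i u=(u_i,u_c)$, $i=1,2$. Suppose that it decomposes into two self-contained subsystems $\dot z_i=f_i(z_i)+g_i(z_i)v_i$ with $v_i\in\mathcal V_i$: for all $x$ and all $u\in\mathcal U$ one has $P_i(f(x)+g(x)u)=f_i(P_ix)+g_i(P_ix)P_iu$, and $u\in\mathcal U$ if and only if $P_1u\in\mathcal V_1$ and $P_2u\in\mathcal V_2$. For each of the three systems the control set is compact and contains $0$, the drift and the control matrix are Lipschitz, and the origin is an equilibrium under the zero control. Let $\gamma>0$ and let $\ell_i$ be a norm on $\mathbb R^{n_i+n_c}$. The control Lyapunov-value function (CLVF) of subsystem $i$ is $$V_i^\infty(z)=\lim_{t\to-\infty}\ \inf_{v(\cdot)}\ \max_{s\in[t,0]}e^{\gamma(s-t)}\ell_i(\zeta(s))\in[0,\infty],$$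 where $v(\cdot)$ ranges over the measurable $\mathcal V_i$-valued signals and $\zeta$ is the corresponding solution with $\zeta(t)=z$. Its domain is $\mathcal D_i=\{V_i^\infty<\infty\}$, and it is assumed that $V_i^\infty$ is locally Lipschitz on $\mathcal D_i$. For an extended-real valued $V$ let $DV(x)[w]=\limsup_{h\downarrow0}\frac{V(x+hw)-V(x)}h$, which is $\nabla V(x)\cdot w$ where $V$ is differentiable. The (time-independent) admissible control set of subsystem $i$ at $z\in\mathcal D_i$ is $$\mathcal U_{a,i}(z)=\{v\in\mathcal V_i: DV_i^\infty(z)[f_i(z)+g_i(z)v]\le-\gamma V_i^\infty(z)\},$$ and $\mathcal U_{a,i}^c(z)$ is the set of the shared components $u_c$ of its elements $(u_i,u_c)$. **Theorem.** Let $\bar V(x)=V_1^\infty(P_1x)+V_2^\infty(P_2x)$, let $c\ge0$, and let $\bar{\mathcal S}_\gamma=\{x:\bar V(x)\le c\}$. Suppose that $\mathcal U_{a,1}^c(P_1x)\cap\mathcal U_{a,2}^c(P_2x)\neq\emptyset$ for every $x\in\bar{\mathcal S}_\gamma$. Then $\bar V$ is a Lipschitz continuous local control Lyapunov function for the full system on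 $\bar{\mathcal S}_\gamma$: it is finite and Lipschitz on $\bar{\mathcal S}_\gamma\ni0$, $\bar V(0)=0$ and $\bar V>0$ on $\bar{\mathcal S}_\gamma\setminus\{0\}$, its sublevel sets in $\bar{\mathcal S}_\gamma$ are compact, and for every $x\in\bar{\mathcal S}_\gamma\setminus\{0\}$ there is $u\in\mathcal U$ with $D\bar V(x)[f(x)+g(x)u]<0$. Moreover, for every $x\in\bar{\mathcal S}_\gamma$ there is $u\in\mathcal U$ with $P_1u\in\mathcal U_{a,1}(P_1x)$ and $P_2u\in\mathcal U_{a,2}(P_2x)$ such that $D\bar V(x)[f(x)+g(x)u]\le-\gamma\bar V(x)$. If $c>0$ and $\mathcal D_1,\mathcal D_2$ are neighbourhoods of the origin, then so is $\bar{\mathcal S}_\gamma$. -/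

import Mathlib

open Set Filter Topology MeasureTheory
open scoped NNReal ENNReal

noncomputable section

/-- A control-affine system `ẋ = f(x) + g(x) u` with compact control set `U`, Lipschitz `f` and `g`,
and the origin as an equilibrium under the (admissible) zero control. -/
structure ControlSystem (X C : Type*) [NormedAddCommGroup X] [NormedSpace ℝ X]
    [NormedAddCommGroup C] [NormedSpace ℝ C] where
  /-- the drift `f` -/
  drift : X → X
  /-- the control matrix `g` -/
  input : X → C →L[ℝ] X
  /-- the control set `U` -/
  controls : Set C
  isCompact_controls : IsCompact controls
  zero_mem_controls : 0 ∈ controls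
  lipschitz_drift : ∃ K : ℝ≥0, LipschitzWith K drift
  lipschitz_input : ∃ K : ℝ≥0, LipschitzWith K input
  equilibrium : drift 0 + input 0 0 = 0

/-- Upper right Dini derivative of an extended-real valued function `V` at `x` in direction `w`.
Where `V` is finite near `x` and differentiable at `x` this is `D V(x) · w`. -/
def upperDini {X : Type*} [AddCommGroup X] [Module ℝ X] (V : X → ℝ≥0∞) (x w : X) : EReal :=
  limsup (fun h : ℝ => ((V (x + h • w) : EReal) - (V x : EReal)) / (h : EReal)) (𝓝[>] 0)

namespace ControlSystem

variable {X C : Type*} [NormedAddCommGroup X] [NormedSpace ℝ X]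
  [NormedAddCommGroup C] [NormedSpace ℝ C]

/-- The right-hand side `f(x) + g(x) u`. -/
def field (S : ControlSystem X C) (x : X) (u : C) : X := S.drift x + S.input x u

/-- Measurable control signals with values in the control set. -/
def IsSignal [MeasurableSpace C] (S : ControlSystem X C) (u : ℝ → C) : Prop :=
  Measurable u ∧ ∀ s, u s ∈ S.controls

/-- `ξ` is the (Carathéodory) solution on `[t, 0]` with `ξ(t) = x` under the control signal `u`. -/
def IsTrajectory (S : ControlSystem X C) (t : ℝ) (x : X) (u : ℝ → C) (ξ : ℝ → X) : Prop :=
  ContinuousOn ξ (Icc t 0) ∧ ∀ s ∈ Icc t 0, ξ s = x + ∫ r in t..s, S.field (ξ r) (u r)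

/-- The time-varying CLVF
`V(x, t) = inf_u max_{s ∈ [t, 0]} exp(γ (s - t)) ℓ(ξ(s; t, x, u))`. -/
def tvCLVF [MeasurableSpace C] (S : ControlSystem X C) (γ : ℝ) (ℓ : Seminorm ℝ X)
    (x : X) (t : ℝ) : ℝ≥0∞ :=
  ⨅ (u : ℝ → C) (_ : S.IsSignal u) (ξ : ℝ → X) (_ : S.IsTrajectory t x u ξ),
    ⨆ s ∈ Icc t 0, ENNReal.ofReal (Real.exp (γ * (s - t)) * ℓ (ξ s))

/-- The control Lyapunov-value function `V^∞(x) = lim_{t → -∞} V(x, t)`, with values in `[0, ∞]`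
(the limit exists, since `V(x, t)` grows as `t` decreases). -/
def clvf [MeasurableSpace C] (S : ControlSystem X C) (γ : ℝ) (ℓ : Seminorm ℝ X) (x : X) : ℝ≥0∞ :=
  limUnder atBot (fun t : ℝ => S.tvCLVF γ ℓ x t)

/-- The domain of the CLVF (region of exponential stabilizability): where it is finite. -/
def domain [MeasurableSpace C] (S : ControlSystem X C) (γ : ℝ) (ℓ : Seminorm ℝ X) : Set X :=
  {x | S.clvf γ ℓ x ≠ ⊤}

/-- The time-independent admissible control set at `x`:
`{u ∈ U : D V^∞(x) · (f(x) + g(x) u) ≤ -γ V^∞(x)}` for `x` in the domain of the CLVF. -/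
def acs [MeasurableSpace C] (S : ControlSystem X C) (γ : ℝ) (ℓ : Seminorm ℝ X) (x : X) : Set C :=
  {u | u ∈ S.controls ∧ x ∈ S.domain γ ℓ ∧
    upperDini (S.clvf γ ℓ) x (S.field x u) ≤ ((-γ * (S.clvf γ ℓ x).toReal : ℝ) : EReal)}

/-- `V` is a Lipschitz continuous local control Lyapunov function for `S` on `A`. -/
structure IsLipschitzLocalCLF (S : ControlSystem X C) (V : X → ℝ≥0∞) (A : Set X) : Prop where
  finite : ∀ x ∈ A, V x ≠ ⊤
  lipschitz : ∃ K : ℝ≥0, LipschitzOnWith K (fun x => (V x).toReal) A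
  zero_mem : 0 ∈ A
  map_zero : V 0 = 0
  pos : ∀ x ∈ A, x ≠ 0 → 0 < V x
  isCompact_sublevel : ∀ c : ℝ≥0, IsCompact {x | x ∈ A ∧ V x ≤ c}
  decrease : ∀ x ∈ A, x ≠ 0 → ∃ u ∈ S.controls, upperDini V x (S.field x u) < 0

end ControlSystem

section Decomposition

variable {α₁ α₂ αc : Type*}

/-- The projection `(a₁, a₂, a_c) ↦ (a₁, a_c)`, for states and for controls. -/
def proj₁ (a : α₁ × α₂ × αc) : α₁ × αc := (a.1, a.2.2)

/-- The projection `(a₁, a₂, a_c) ↦ (a₂, a_c)`, for states and for controls. -/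
def proj₂ (a : α₁ × α₂ × αc) : α₂ × αc := (a.2.1, a.2.2)

/-- The shared component of a set of controls `(u_i, u_c)`. -/
def sharedComponent {α : Type*} (A : Set (α × αc)) : Set αc := Prod.snd '' A

variable {X₁ X₂ Xc C₁ C₂ Cc : Type*}
  [NormedAddCommGroup X₁] [NormedSpace ℝ X₁] [NormedAddCommGroup X₂] [NormedSpace ℝ X₂]
  [NormedAddCommGroup Xc] [NormedSpace ℝ Xc] [NormedAddCommGroup C₁] [NormedSpace ℝ C₁]
  [NormedAddCommGroup C₂] [NormedSpace ℝ C₂] [NormedAddCommGroup Cc] [NormedSpace ℝ Cc]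

/-- `S₁` and `S₂` are the self-contained subsystems of `S` for the partitions
`x = (x₁, x₂, x_c)`, `u = (u₁, u₂, u_c)`. -/
structure IsSCSD (S : ControlSystem (X₁ × X₂ × Xc) (C₁ × C₂ × Cc))
    (S₁ : ControlSystem (X₁ × Xc) (C₁ × Cc)) (S₂ : ControlSystem (X₂ × Xc) (C₂ × Cc)) : Prop where
  mem_controls_iff : ∀ u, u ∈ S.controls ↔ proj₁ u ∈ S₁.controls ∧ proj₂ u ∈ S₂.controls
  proj₁_field : ∀ x, ∀ u ∈ S.controls, proj₁ (S.field x u) = S₁.field (proj₁ x) (proj₁ u)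
  proj₂_field : ∀ x, ∀ u ∈ S.controls, proj₂ (S.field x u) = S₂.field (proj₂ x) (proj₂ u)

variable [MeasurableSpace C₁] [MeasurableSpace C₂] [MeasurableSpace Cc]

/-- The reconstructed function `V̄(x) = V₁^∞(P₁ x) + V₂^∞(P₂ x)`. -/
def reconstructed (S₁ : ControlSystem (X₁ × Xc) (C₁ × Cc)) (S₂ : ControlSystem (X₂ × Xc) (C₂ × Cc))
    (γ : ℝ) (ℓ₁ : Seminorm ℝ (X₁ × Xc)) (ℓ₂ : Seminorm ℝ (X₂ × Xc)) (x : X₁ × X₂ × Xc) : ℝ≥0∞ :=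
  S₁.clvf γ ℓ₁ (proj₁ x) + S₂.clvf γ ℓ₂ (proj₂ x)

/-- The reconstructed admissible control set. -/
def reconstructedACS (S : ControlSystem (X₁ × X₂ × Xc) (C₁ × C₂ × Cc))
    (S₁ : ControlSystem (X₁ × Xc) (C₁ × Cc)) (S₂ : ControlSystem (X₂ × Xc) (C₂ × Cc))
    (γ : ℝ) (ℓ₁ : Seminorm ℝ (X₁ × Xc)) (ℓ₂ : Seminorm ℝ (X₂ × Xc)) (x : X₁ × X₂ × Xc) :
    Set (C₁ × C₂ × Cc) :=
  {u | u ∈ S.controls ∧ proj₁ u ∈ S₁.acs γ ℓ₁ (proj₁ x) ∧ proj₂ u ∈ S₂.acs γ ℓ₂ (proj₂ x)}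

/-- The reconstructed shared control component: the intersection of the shared components of the
admissible control sets of the subsystems. -/
def reconstructedSharedACS
    (S₁ : ControlSystem (X₁ × Xc) (C₁ × Cc)) (S₂ : ControlSystem (X₂ × Xc) (C₂ × Cc))
    (γ : ℝ) (ℓ₁ : Seminorm ℝ (X₁ × Xc)) (ℓ₂ : Seminorm ℝ (X₂ × Xc)) (x : X₁ × X₂ × Xc) :
    Set Cc :=
  sharedComponent (S₁.acs γ ℓ₁ (proj₁ x)) ∩ sharedComponent (S₂.acs γ ℓ₂ (proj₂ x))

/-- The (sub)level set `{x : V̄(x) ≤ c}` of the reconstructed function. -/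
def levelSet (S₁ : ControlSystem (X₁ × Xc) (C₁ × Cc)) (S₂ : ControlSystem (X₂ × Xc) (C₂ × Cc))
    (γ : ℝ) (ℓ₁ : Seminorm ℝ (X₁ × Xc)) (ℓ₂ : Seminorm ℝ (X₂ × Xc)) (c : ℝ≥0) :
    Set (X₁ × X₂ × Xc) :=
  {x | reconstructed S₁ S₂ γ ℓ₁ ℓ₂ x ≤ c}

end Decomposition

end

/-! Decrease is pure gluing. If `(u₁, uc)` and `(u₂, uc)` are admissible for the two subsystems,
then `(u₁, u₂, uc)` is a control of the full system, its velocity projects to the two subsystem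
velocities, and upper Dini derivatives are subadditive. Adding the two inequalities `≤ -γ Vᵢ` gives
`≤ -γ V̄` (`exists_mem_reconstructedACS`, `upperDini_add_le`).

The rest needs facts about each CLVF. The value grows with the horizon, so `V^∞` is a supremum over
`t` (`clvf_eq_iSup`). The horizon `t = 0` gives `V^∞ ≥ ℓ`, hence positivity off the origin and
bounded sublevel sets. For fixed `t` the value is Lipschitz in the initial state, because solutions
are, so `V^∞` is lower semicontinuous as a supremum of such functions (`lowerSemicontinuous_clvf`)
and sublevel sets are closed. Hence the level sets of `V̄` are compact (`isCompact_levelSet`), and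
on a compact set local Lipschitz continuity is global. -/

noncomputable section

/-! ### Comparison of seminorms with the norm in finite dimension -/

namespace Seminorm

variable {E : Type*} [NormedAddCommGroup E] [NormedSpace ℝ E] [FiniteDimensional ℝ E]

theorem continuous_of_finiteDimensional (p : Seminorm ℝ E) : Continuous p :=
  p.convexOn.locallyLipschitz.continuous

theorem exists_pos_le_mul_norm (p : Seminorm ℝ E) : ∃ C, 0 < C ∧ ∀ x, p x ≤ C * ‖x‖ :=
  p.bound_of_continuous_normedSpace p.continuous_of_finiteDimensional

theorem exists_pos_norm_le_mul (p : Seminorm ℝ E) (hp : ∀ x, p x = 0 → x = 0) :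
    ∃ C, 0 < C ∧ ∀ x, ‖x‖ ≤ C * p x := by
  rcases subsingleton_or_nontrivial E with h | h
  · exact ⟨1, one_pos, fun x => by simp [Subsingleton.elim x 0]⟩
  · have : ProperSpace E := FiniteDimensional.proper ℝ E
    -- The constant is the inverse of the minimum of `p` on the unit sphere, positive by
    -- definiteness.
    obtain ⟨y, hy, hmin⟩ := (isCompact_sphere (0 : E) 1).exists_isMinOn
      ((NormedSpace.sphere_nonempty (x := (0 : E))).2 zero_le_one)
      p.continuous_of_finiteDimensional.continuousOn
    have hy1 : ‖y‖ = 1 := by simpa using hy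
    have hpy : 0 < p y := lt_of_le_of_ne (apply_nonneg p y) fun h0 => by
      simp [hp y h0.symm] at hy1
    refine ⟨(p y)⁻¹, inv_pos.2 hpy, fun x => ?_⟩
    rcases eq_or_ne x 0 with rfl | hx
    · simp
    have hx' : 0 < ‖x‖ := norm_pos_iff.2 hx
    have h1 : p y ≤ p (‖x‖⁻¹ • x) := hmin (by simp [norm_smul, hx'.ne'])
    rw [map_smul_eq_mul, norm_inv, norm_norm, inv_mul_eq_div, le_div_iff₀ hx'] at h1
    rwa [inv_mul_eq_div, le_div_iff₀ hpy, mul_comm]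

end Seminorm

namespace ControlSystem

/-! ### Control signals and trajectories -/

section Signals

variable {X C : Type*} [NormedAddCommGroup X] [NormedSpace ℝ X]
  [NormedAddCommGroup C] [NormedSpace ℝ C]

theorem field_zero_zero (S : ControlSystem X C) : S.field 0 0 = 0 := S.equilibrium

theorem exists_field_lipschitz (S : ControlSystem X C) :
    ∃ L : ℝ, 0 < L ∧ ∀ u ∈ S.controls, ∀ x y, ‖S.field x u - S.field y u‖ ≤ L * ‖x - y‖ := by
  obtain ⟨K, hK⟩ := S.lipschitz_drift
  obtain ⟨K', hK'⟩ := S.lipschitz_input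
  obtain ⟨M, hM, hu⟩ := S.isCompact_controls.isBounded.exists_pos_norm_le
  -- `M` bounds the compact control set; the `+ 1` only makes the constant strictly positive.
  refine ⟨K + K' * M + 1, by positivity, fun u hu' x y => ?_⟩
  have h1 : S.field x u - S.field y u
      = (S.drift x - S.drift y) + (S.input x - S.input y) u := by
    simp only [field, sub_apply]; abel
  have h2 : ‖(S.input x - S.input y) u‖ ≤ (K' * ‖x - y‖) * M :=
    (ContinuousLinearMap.le_opNorm _ _).trans
      (mul_le_mul (hK'.norm_sub_le x y) (hu u hu') (norm_nonneg _) (by positivity))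
  rw [h1]
  refine (norm_add_le _ _).trans ((add_le_add (hK.norm_sub_le x y) h2).trans ?_)
  nlinarith [norm_nonneg (x - y)]

theorem isTrajectory_zero (S : ControlSystem X C) (t : ℝ) :
    S.IsTrajectory t 0 (fun _ => 0) fun _ => 0 :=
  ⟨continuousOn_const, fun s _ => by simp [field_zero_zero]⟩

/-- Time translation of a trajectory to a shorter horizon. -/
theorem IsTrajectory.comp_add_right {S : ControlSystem X C} {u : ℝ → C} {ξ : ℝ → X} {t t' : ℝ}
    {x : X} (h : S.IsTrajectory t' x u ξ) (htt : t' ≤ t) :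
    S.IsTrajectory t x (fun s => u (s + (t' - t))) fun s => ξ (s + (t' - t)) := by
  have hmaps : ∀ s ∈ Icc t 0, s + (t' - t) ∈ Icc t' 0 := fun s hs =>
    ⟨by linarith [hs.1], by linarith [hs.2]⟩
  refine ⟨h.1.comp (by fun_prop) hmaps, fun s hs => ?_⟩
  beta_reduce
  rw [h.2 _ (hmaps s hs),
    intervalIntegral.integral_comp_add_right (fun r => S.field (ξ r) (u r)) (t' - t)]
  simp

variable [MeasurableSpace C]

theorem isSignal_zero (S : ControlSystem X C) : S.IsSignal fun _ => 0 :=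
  ⟨measurable_const, fun _ => S.zero_mem_controls⟩

theorem IsSignal.comp_add_right {S : ControlSystem X C} {u : ℝ → C} (hu : S.IsSignal u) (a : ℝ) :
    S.IsSignal fun s => u (s + a) :=
  ⟨hu.1.comp (measurable_add_const a), fun s => hu.2 (s + a)⟩

theorem intervalIntegrable_field [OpensMeasurableSpace C] [SecondCountableTopology C]
    (S : ControlSystem X C) {u : ℝ → C} (hu : S.IsSignal u) {ξ : ℝ → X} (hξ : Continuous ξ)
    (a b : ℝ) : IntervalIntegrable (fun r => S.field (ξ r) (u r)) volume a b := by
  obtain ⟨K, hK⟩ := S.lipschitz_drift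
  obtain ⟨K', hK'⟩ := S.lipschitz_input
  obtain ⟨M, hM, hM'⟩ := S.isCompact_controls.isBounded.exists_pos_norm_le
  have hd : Continuous fun r => S.drift (ξ r) := hK.continuous.comp hξ
  have hi : Continuous fun r => S.input (ξ r) := hK'.continuous.comp hξ
  have hmeas : StronglyMeasurable fun r => S.field (ξ r) (u r) :=
    hd.stronglyMeasurable.add <|
      (isBoundedBilinearMap_apply (𝕜 := ℝ) (E := C) (F := X)).continuous.comp_stronglyMeasurable
        (hi.stronglyMeasurable.prodMk hu.1.stronglyMeasurable)
  have hbound : Continuous fun r => ‖S.drift (ξ r)‖ + ‖S.input (ξ r)‖ * M := by fun_prop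
  refine (hbound.intervalIntegrable a b).mono_fun' hmeas.aestronglyMeasurable
    (ae_of_all _ fun r => ?_)
  exact (norm_add_le _ _).trans (add_le_add le_rfl
    ((ContinuousLinearMap.le_opNorm _ _).trans (by gcongr; exact hM' _ (hu.2 r))))

end Signals

/-! ### Existence of solutions and dependence on the initial state -/

section Flow

variable {X C : Type*} [NormedAddCommGroup X] [NormedSpace ℝ X]
  [NormedAddCommGroup C] [NormedSpace ℝ C] [MeasurableSpace C] [OpensMeasurableSpace C]
  [SecondCountableTopology C]

/-- The Picard operator for initial value `y` at time `t`, conjugated by the weight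
`exp (k (s - t))` so that it is a contraction on `C([t, 0], X)` for large `k`. -/
def weightedPicard (S : ControlSystem X C) {t : ℝ} (ht : t ≤ 0) (k : ℝ) {u : ℝ → C}
    (hu : S.IsSignal u) (y : X) (η : C(Icc t 0, X)) : C(Icc t 0, X) where
  toFun s := Real.exp (-(k * (s - t))) •
    (y + ∫ r in t..s, S.field (Real.exp (k * (r - t)) • η (projIcc t 0 ht r)) (u r))
  -- `projIcc` extends `η` continuously to all of `ℝ`, so the integrand is integrable on every
  -- interval.
  continuous_toFun := by
    have h : Continuous fun s : ℝ =>
        ∫ r in t..s, S.field (Real.exp (k * (r - t)) • η (projIcc t 0 ht r)) (u r) :=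
      intervalIntegral.continuous_primitive
        (fun a b => S.intervalIntegrable_field hu (by fun_prop) a b) t
    fun_prop

theorem integral_exp_mul_sub_le {k t s : ℝ} (hk : 0 < k) :
    ∫ r in t..s, Real.exp (k * (r - t)) ≤ k⁻¹ * Real.exp (k * (s - t)) := by
  have hderiv : ∀ r ∈ uIcc t s, HasDerivAt (fun r => k⁻¹ * Real.exp (k * (r - t)))
      (Real.exp (k * (r - t))) r := fun r _ => by
    have h := ((((hasDerivAt_id r).sub_const t).const_mul k).exp).const_mul k⁻¹
    refine h.congr_deriv ?_
    simp only [id]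
    field_simp
  rw [intervalIntegral.integral_eq_sub_of_hasDerivAt hderiv
    (Continuous.intervalIntegrable (by fun_prop) _ _)]
  simp only [sub_le_self_iff]
  positivity

/-- Integrating the weight `exp (k (r - t))` gains a factor `1 / k`, so the contraction constant is
`L / k = 1 / 2`, whatever the length of the horizon. -/
theorem dist_weightedPicard_le (S : ControlSystem X C) {k L : ℝ} (hL : 0 < L) (hk : k = 2 * L)
    (hS : ∀ u ∈ S.controls, ∀ x y, ‖S.field x u - S.field y u‖ ≤ L * ‖x - y‖)
    {t : ℝ} (ht : t ≤ 0) {u : ℝ → C} (hu : S.IsSignal u) (y : X) (η ζ : C(Icc t 0, X)) :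
    dist (S.weightedPicard ht k hu y η) (S.weightedPicard ht k hu y ζ)
      ≤ 2⁻¹ * dist η ζ := by
  rw [ContinuousMap.dist_le (by positivity)]
  intro s
  have hk0 : 0 < k := by linarith
  have hint : ∀ θ : C(Icc t 0, X), IntervalIntegrable (fun r =>
      S.field (Real.exp (k * (r - t)) • θ (projIcc t 0 ht r)) (u r)) volume t s := fun θ =>
    S.intervalIntegrable_field hu (by fun_prop) _ _
  have hle : ‖∫ r in t..s, (S.field (Real.exp (k * (r - t)) • η (projIcc t 0 ht r)) (u r)
        - S.field (Real.exp (k * (r - t)) • ζ (projIcc t 0 ht r)) (u r))‖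
      ≤ ∫ r in t..s, L * dist η ζ * Real.exp (k * (r - t)) := by
    refine intervalIntegral.norm_integral_le_of_norm_le s.2.1 (ae_of_all _ fun r _ => ?_)
      (Continuous.intervalIntegrable (by fun_prop) _ _)
    refine (hS _ (hu.2 r) _ _).trans ?_
    rw [← smul_sub, norm_smul, Real.norm_of_nonneg (Real.exp_pos _).le, mul_assoc, ← dist_eq_norm,
      mul_comm (dist η ζ)]
    gcongr
    exact ContinuousMap.dist_apply_le_dist _
  rw [intervalIntegral.integral_const_mul] at hle
  rw [dist_eq_norm]
  simp only [weightedPicard, ContinuousMap.coe_mk]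
  rw [← smul_sub, add_sub_add_left_eq_sub, ← intervalIntegral.integral_sub (hint η) (hint ζ),
    norm_smul, Real.norm_of_nonneg (Real.exp_pos _).le]
  calc Real.exp (-(k * (s - t))) * _
      ≤ Real.exp (-(k * (s - t))) * (L * dist η ζ * (k⁻¹ * Real.exp (k * (s - t)))) := by
        gcongr
        exact hle.trans (by gcongr; exact integral_exp_mul_sub_le hk0)
    _ = (Real.exp (-(k * (s - t))) * Real.exp (k * (s - t))) * (L * k⁻¹ * dist η ζ) := by ring
    _ = 2⁻¹ * dist η ζ := by
        rw [← Real.exp_add, neg_add_cancel, Real.exp_zero, hk]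
        field_simp

/-- Solutions exist from every initial state, and depend Lipschitz continuously on it. -/
theorem exists_isTrajectory_near [CompleteSpace X] (S : ControlSystem X C) {t : ℝ} (ht : t ≤ 0) :
    ∃ M : ℝ, 0 < M ∧ ∀ (u : ℝ → C), S.IsSignal u → ∀ (x y : X) (ξ : ℝ → X),
      S.IsTrajectory t x u ξ →
        ∃ ζ, S.IsTrajectory t y u ζ ∧ ∀ s ∈ Icc t 0, ‖ζ s - ξ s‖ ≤ M * ‖y - x‖ := by
  obtain ⟨L, hL, hS⟩ := S.exists_field_lipschitz
  obtain ⟨k, hk⟩ : ∃ k, k = 2 * L := ⟨_, rfl⟩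
  have hk0 : 0 < k := by linarith
  -- The factor `2 = 1 / (1 - 1/2)` comes from the fixed-point estimate, the exponential from
  -- undoing the weight on `[t, 0]`.
  refine ⟨2 * Real.exp (k * (0 - t)), by positivity, fun u hu x y ξ hξ => ?_⟩
  have hT : ContractingWith 2⁻¹ (S.weightedPicard ht k hu y) :=
    ⟨by norm_num, LipschitzWith.of_dist_le_mul fun η ζ => by
      simpa using S.dist_weightedPicard_le hL hk hS ht hu y η ζ⟩
  let η : C(Icc t 0, X) := ⟨fun s => Real.exp (-(k * (s - t))) • ξ s, by
    have h : Continuous fun s : Icc t 0 => ξ s := continuousOn_iff_continuous_domRestrict.1 hξ.1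
    exact Continuous.smul (by fun_prop) h⟩
  let θ := ContractingWith.fixedPoint _ hT
  have hθ : S.weightedPicard ht k hu y θ = θ := hT.fixedPoint_isFixedPt
  have hexp : ∀ s, Real.exp (k * (s - t)) * Real.exp (-(k * (s - t))) = 1 := fun s => by
    rw [← Real.exp_add, add_neg_cancel, Real.exp_zero]
  -- The given solution from `x` is almost fixed by the Picard operator for `y`: only the initial
  -- value changes. One contraction argument then yields both existence from `y` and closeness to
  -- `ξ`.
  have hη : dist η (S.weightedPicard ht k hu y η) ≤ ‖y - x‖ := by
    rw [ContinuousMap.dist_le (norm_nonneg _)]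
    intro s
    have hcongr : ∫ r in t..s, S.field (Real.exp (k * (r - t)) • η (projIcc t 0 ht r)) (u r)
        = ∫ r in t..s, S.field (ξ r) (u r) := by
      refine intervalIntegral.integral_congr fun r hr => ?_
      rw [uIcc_of_le s.2.1] at hr
      have hr' : r ∈ Icc t 0 := ⟨hr.1, hr.2.trans s.2.2⟩
      simp only [η, ContinuousMap.coe_mk, projIcc_of_mem ht hr', smul_smul, hexp, one_smul]
    rw [dist_comm, dist_eq_norm]
    simp only [weightedPicard, ContinuousMap.coe_mk, hcongr]
    simp only [η, ContinuousMap.coe_mk]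
    rw [hξ.2 s s.2, ← smul_sub, add_sub_add_right_eq_sub, norm_smul,
      Real.norm_of_nonneg (Real.exp_pos _).le]
    refine mul_le_of_le_one_left (norm_nonneg _) (Real.exp_le_one_iff.2 ?_)
    have := s.2.1
    nlinarith
  have hdist : dist η θ ≤ 2 * ‖y - x‖ := by
    have h := hT.dist_fixedPoint_le η
    have h2 : (1 : ℝ) - ((2⁻¹ : ℝ≥0) : ℝ) = 2⁻¹ := by norm_num
    rw [h2, div_inv_eq_mul] at h
    exact h.trans (by linarith)
  have hθc : Continuous fun s : ℝ => Real.exp (k * (s - t)) • θ (projIcc t 0 ht s) := by fun_prop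
  refine ⟨fun s => Real.exp (k * (s - t)) • θ (projIcc t 0 ht s), ⟨hθc.continuousOn,
    fun s hs => ?_⟩, fun s hs => ?_⟩
  · have h := congrArg (fun f => f ⟨s, hs⟩) hθ
    simp only [weightedPicard, ContinuousMap.coe_mk] at h
    simp only [projIcc_of_mem ht hs, ← h, smul_smul, hexp, one_smul]
  · have h1 : ξ s = Real.exp (k * (s - t)) • η ⟨s, hs⟩ := by
      simp only [η, ContinuousMap.coe_mk, smul_smul, hexp, one_smul]
    beta_reduce
    rw [h1, projIcc_of_mem ht hs, ← smul_sub, norm_smul, Real.norm_of_nonneg (Real.exp_pos _).le,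
      mul_comm 2, mul_assoc]
    gcongr
    · exact hs.2
    · rw [← dist_eq_norm, dist_comm]
      exact (ContinuousMap.dist_apply_le_dist _).trans hdist

end Flow

end ControlSystem

/-! ### Properties of the control Lyapunov-value function -/

namespace ControlSystem

variable {X C : Type*} [NormedAddCommGroup X] [NormedSpace ℝ X]
  [NormedAddCommGroup C] [NormedSpace ℝ C] [MeasurableSpace C]

theorem tvCLVF_le (S : ControlSystem X C) (γ : ℝ) (ℓ : Seminorm ℝ X) {t : ℝ} {x : X} {u : ℝ → C}
    {ξ : ℝ → X} (hu : S.IsSignal u) (hξ : S.IsTrajectory t x u ξ) :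
    S.tvCLVF γ ℓ x t ≤ ⨆ s ∈ Icc t 0, ENNReal.ofReal (Real.exp (γ * (s - t)) * ℓ (ξ s)) :=
  iInf₂_le_of_le u hu (iInf₂_le ξ hξ)

theorem tvCLVF_zero (S : ControlSystem X C) (γ : ℝ) (ℓ : Seminorm ℝ X) (t : ℝ) :
    S.tvCLVF γ ℓ 0 t = 0 :=
  le_antisymm ((S.tvCLVF_le γ ℓ S.isSignal_zero (S.isTrajectory_zero t)).trans (by simp)) zero_le

/-- For positive `t` the interval `[t, 0]` is empty and the inner supremum is `0`; so letting `t`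
range over all of `ℝ` does no harm. -/
theorem tvCLVF_of_pos (S : ControlSystem X C) (γ : ℝ) (ℓ : Seminorm ℝ X) (x : X) {t : ℝ}
    (ht : 0 < t) : S.tvCLVF γ ℓ x t = 0 :=
  le_antisymm ((S.tvCLVF_le (ξ := fun _ => x) γ ℓ S.isSignal_zero
    ⟨continuousOn_const, by simp [Icc_eq_empty_of_lt ht]⟩).trans
      (by simp [Icc_eq_empty_of_lt ht])) zero_le

/-- The dynamics are autonomous and the weight depends only on elapsed time, so the initial piece of
a long trajectory, shifted in time, competes on the shorter horizon at no greater cost. -/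
theorem tvCLVF_antitone (S : ControlSystem X C) (γ : ℝ) (ℓ : Seminorm ℝ X) (x : X) :
    Antitone fun t => S.tvCLVF γ ℓ x t := by
  intro t' t htt
  refine le_iInf₂ fun u hu => le_iInf₂ fun ξ hξ => ?_
  refine (S.tvCLVF_le γ ℓ (hu.comp_add_right (t' - t)) (hξ.comp_add_right htt)).trans
    (iSup₂_le fun s hs => ?_)
  refine le_trans (le_of_eq ?_)
    (le_iSup₂ (s + (t' - t)) (⟨by linarith [hs.1], by linarith [hs.2]⟩ : _ ∈ Icc t' 0))
  ring_nf

theorem clvf_eq_iSup (S : ControlSystem X C) (γ : ℝ) (ℓ : Seminorm ℝ X) (x : X) :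
    S.clvf γ ℓ x = ⨆ t, S.tvCLVF γ ℓ x t :=
  (tendsto_atBot_iSup (S.tvCLVF_antitone γ ℓ x)).limUnder_eq

theorem clvf_zero (S : ControlSystem X C) (γ : ℝ) (ℓ : Seminorm ℝ X) : S.clvf γ ℓ 0 = 0 := by
  simp [clvf_eq_iSup, tvCLVF_zero]

theorem ofReal_seminorm_le_clvf (S : ControlSystem X C) (γ : ℝ) (ℓ : Seminorm ℝ X) (x : X) :
    ENNReal.ofReal (ℓ x) ≤ S.clvf γ ℓ x := by
  rw [clvf_eq_iSup]
  -- At horizon `t = 0` the only time is the initial one, and the cost is `ℓ x`.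
  refine le_iSup_of_le 0 (le_iInf₂ fun u hu => le_iInf₂ fun ξ hξ => ?_)
  have h0 : ξ 0 = x := by simpa using hξ.2 0 (by simp)
  refine le_trans (le_of_eq ?_) (le_iSup₂ (0 : ℝ) (by simp : (0 : ℝ) ∈ Icc (0 : ℝ) 0))
  simp [h0]

theorem clvf_eq_zero_iff (S : ControlSystem X C) (γ : ℝ) {ℓ : Seminorm ℝ X}
    (hℓ : ∀ z, ℓ z = 0 → z = 0) {x : X} : S.clvf γ ℓ x = 0 ↔ x = 0 := by
  refine ⟨fun h => hℓ x ?_, fun h => h ▸ S.clvf_zero γ ℓ⟩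
  have h1 := S.ofReal_seminorm_le_clvf γ ℓ x
  rw [h, nonpos_iff_eq_zero, ENNReal.ofReal_eq_zero] at h1
  exact le_antisymm h1 (apply_nonneg ℓ x)

/-- Each competitor for `x` is matched, under the same signal, by a nearby trajectory from `y`.
Existence of that trajectory matters: an infimum over no trajectories would be `⊤`. -/
theorem exists_tvCLVF_le_add [FiniteDimensional ℝ X] [OpensMeasurableSpace C]
    [SecondCountableTopology C] (S : ControlSystem X C) {γ : ℝ} (hγ : 0 ≤ γ) (ℓ : Seminorm ℝ X)
    (t : ℝ) : ∃ M : ℝ, ∀ x y,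
      S.tvCLVF γ ℓ y t ≤ S.tvCLVF γ ℓ x t + ENNReal.ofReal (M * ‖y - x‖) := by
  rcases lt_or_ge 0 t with ht | ht
  · exact ⟨0, fun x y => by simp [tvCLVF_of_pos _ _ _ _ ht]⟩
  have : CompleteSpace X := FiniteDimensional.complete ℝ X
  obtain ⟨M, hM, hnear⟩ := S.exists_isTrajectory_near ht
  obtain ⟨B, hB, hℓB⟩ := ℓ.exists_pos_le_mul_norm
  refine ⟨Real.exp (γ * (0 - t)) * (B * M), fun x y => ?_⟩
  simp only [tvCLVF, ENNReal.iInf_add]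
  refine le_iInf₂ fun u hu => le_iInf₂ fun ξ hξ => ?_
  obtain ⟨ζ, hζ, hζξ⟩ := hnear u hu x y ξ hξ
  refine (S.tvCLVF_le γ ℓ hu hζ).trans (iSup₂_le fun s hs => ?_)
  refine le_trans ?_ (add_le_add
    (le_iSup₂ (f := fun s (_ : s ∈ Icc t 0) => ENNReal.ofReal (Real.exp (γ * (s - t)) * ℓ (ξ s)))
      s hs) le_rfl)
  have h1 : ℓ (ζ s) ≤ ℓ (ξ s) + B * (M * ‖y - x‖) := by
    calc ℓ (ζ s) = ℓ (ξ s + (ζ s - ξ s)) := by rw [add_sub_cancel]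
      _ ≤ ℓ (ξ s) + ℓ (ζ s - ξ s) := map_add_le_add ℓ _ _
      _ ≤ _ := by grw [hℓB (ζ s - ξ s), hζξ s hs]
  rw [← ENNReal.ofReal_add (by positivity) (by positivity)]
  refine ENNReal.ofReal_le_ofReal ?_
  calc Real.exp (γ * (s - t)) * ℓ (ζ s)
      ≤ Real.exp (γ * (s - t)) * (ℓ (ξ s) + B * (M * ‖y - x‖)) := by gcongr
    _ = Real.exp (γ * (s - t)) * ℓ (ξ s) + Real.exp (γ * (s - t)) * (B * M) * ‖y - x‖ := by ring
    _ ≤ _ := by gcongr; exact hs.2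

theorem lowerSemicontinuous_clvf [FiniteDimensional ℝ X] [OpensMeasurableSpace C]
    [SecondCountableTopology C] (S : ControlSystem X C) {γ : ℝ} (hγ : 0 ≤ γ) (ℓ : Seminorm ℝ X) :
    LowerSemicontinuous (S.clvf γ ℓ) := by
  have h : S.clvf γ ℓ = fun x => ⨆ t, S.tvCLVF γ ℓ x t := funext (S.clvf_eq_iSup γ ℓ)
  rw [h]
  refine lowerSemicontinuous_iSup fun t => lowerSemicontinuous_iff_isClosed_preimage.2 fun a => ?_
  obtain ⟨M, hM⟩ := S.exists_tvCLVF_le_add hγ ℓ t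
  -- The additive estimate transfers the bound `a` from `x n` to the limit `y`, with an error
  -- tending to zero.
  refine IsSeqClosed.isClosed fun x y hx hxy => ?_
  have hlim : Tendsto (fun n => a + ENNReal.ofReal (M * ‖y - x n‖)) atTop (𝓝 a) := by
    have h0 : Tendsto (fun n => M * ‖y - x n‖) atTop (𝓝 0) := by
      simpa using ((tendsto_const_nhds (x := y)).sub hxy).norm.const_mul M
    simpa using tendsto_const_nhds.add (ENNReal.tendsto_ofReal h0)
  exact ge_of_tendsto' hlim fun n => (hM (x n) y).trans (add_le_add (hx n) le_rfl)

theorem continuousAt_clvf_zero (S : ControlSystem X C) {γ : ℝ} {ℓ : Seminorm ℝ X}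
    (hV : LocallyLipschitzOn (S.domain γ ℓ) fun z => (S.clvf γ ℓ z).toReal)
    (hD : S.domain γ ℓ ∈ 𝓝 0) : ContinuousAt (S.clvf γ ℓ) 0 := by
  have h1 : ContinuousAt (fun z => (S.clvf γ ℓ z).toReal) 0 := hV.continuousOn.continuousAt hD
  refine (ENNReal.continuous_ofReal.continuousAt.comp h1).congr ?_
  filter_upwards [hD] with z hz
  exact ENNReal.ofReal_toReal hz

end ControlSystem

/-! ### Subadditivity of the upper Dini derivative -/

/-- The difference quotient of the sum splits, as `V (p z)` is finite, and a limsup of sums is at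
most the sum of limsups. The real upper bounds exclude the ambiguous sum `⊤ + ⊥`. -/
theorem upperDini_add_le {X Y Z : Type*} [AddCommGroup X] [Module ℝ X] [AddCommGroup Y]
    [Module ℝ Y] [AddCommGroup Z] [Module ℝ Z] {V : X → ℝ≥0∞} {W : Y → ℝ≥0∞} {p : Z → X}
    {q : Z → Y} {z w : Z} (hp : ∀ h : ℝ, p (z + h • w) = p z + h • p w)
    (hq : ∀ h : ℝ, q (z + h • w) = q z + h • q w) (hV : V (p z) ≠ ⊤) {a b : ℝ}
    (ha : upperDini V (p z) (p w) ≤ (a : EReal)) (hb : upperDini W (q z) (q w) ≤ (b : EReal)) :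
    upperDini (fun z => V (p z) + W (q z)) z w ≤ ((a + b : ℝ) : EReal) := by
  have ha' : upperDini V (p z) (p w) ≠ ⊤ := (ha.trans_lt (EReal.coe_lt_top a)).ne
  have hb' : upperDini W (q z) (q w) ≠ ⊤ := (hb.trans_lt (EReal.coe_lt_top b)).ne
  rw [EReal.coe_add]
  refine le_trans ?_ (add_le_add ha hb)
  refine le_trans (le_of_eq ?_) (EReal.limsup_add_le (.inr hb') (.inl ha'))
  refine limsup_congr ?_
  filter_upwards [self_mem_nhdsWithin] with h hh
  have hh0 : (0 : EReal) ≤ h := EReal.coe_nonneg.2 (le_of_lt hh)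
  simp only [Pi.add_apply, hp, hq]
  rw [← EReal.add_div_of_nonneg_right hh0, EReal.coe_ennreal_add, EReal.coe_ennreal_add,
    EReal.add_sub_add_comm (.inl (EReal.coe_ennreal_ne_bot _))
      (.inl (EReal.coe_ennreal_eq_top_iff.not.2 hV))]

/-! ### The projections onto the subsystem coordinates -/

section Projections

variable {X₁ X₂ Xc : Type*} [NormedAddCommGroup X₁] [NormedAddCommGroup X₂] [NormedAddCommGroup Xc]

theorem lipschitzWith_proj₁ : LipschitzWith 1 (proj₁ : X₁ × X₂ × Xc → X₁ × Xc) := by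
  have h := (LipschitzWith.prod_fst (α := X₁) (β := X₂ × Xc)).prodMk
    (LipschitzWith.prod_snd.comp LipschitzWith.prod_snd)
  rwa [one_mul, max_self] at h

theorem lipschitzWith_proj₂ : LipschitzWith 1 (proj₂ : X₁ × X₂ × Xc → X₂ × Xc) :=
  LipschitzWith.prod_snd

theorem proj_eq_zero_iff {x : X₁ × X₂ × Xc} :
    x = 0 ↔ proj₁ x = 0 ∧ proj₂ x = 0 := by
  obtain ⟨a, b, c⟩ := x
  simp only [proj₁, proj₂, Prod.mk_eq_zero]
  tauto

end Projections

/-! ### The reconstructed function and its level sets -/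

section Decomposition

variable {X₁ X₂ Xc C₁ C₂ Cc : Type*}
  [NormedAddCommGroup X₁] [NormedSpace ℝ X₁] [NormedAddCommGroup X₂] [NormedSpace ℝ X₂]
  [NormedAddCommGroup Xc] [NormedSpace ℝ Xc] [NormedAddCommGroup C₁] [NormedSpace ℝ C₁]
  [NormedAddCommGroup C₂] [NormedSpace ℝ C₂] [NormedAddCommGroup Cc] [NormedSpace ℝ Cc]

variable [MeasurableSpace C₁] [MeasurableSpace C₂] [MeasurableSpace Cc]
  {S : ControlSystem (X₁ × X₂ × Xc) (C₁ × C₂ × Cc)}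
  (S₁ : ControlSystem (X₁ × Xc) (C₁ × Cc)) (S₂ : ControlSystem (X₂ × Xc) (C₂ × Cc))

theorem reconstructed_zero (γ : ℝ) (ℓ₁ : Seminorm ℝ (X₁ × Xc)) (ℓ₂ : Seminorm ℝ (X₂ × Xc)) :
    reconstructed S₁ S₂ γ ℓ₁ ℓ₂ 0 = 0 := by
  have h₁ : proj₁ (0 : X₁ × X₂ × Xc) = 0 := rfl
  have h₂ : proj₂ (0 : X₁ × X₂ × Xc) = 0 := rfl
  simp [reconstructed, h₁, h₂, ControlSystem.clvf_zero]

theorem reconstructed_eq_zero_iff (γ : ℝ) {ℓ₁ : Seminorm ℝ (X₁ × Xc)} {ℓ₂ : Seminorm ℝ (X₂ × Xc)}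
    (hℓ₁ : ∀ z, ℓ₁ z = 0 → z = 0) (hℓ₂ : ∀ z, ℓ₂ z = 0 → z = 0) {x : X₁ × X₂ × Xc} :
    reconstructed S₁ S₂ γ ℓ₁ ℓ₂ x = 0 ↔ x = 0 := by
  rw [reconstructed, add_eq_zero, S₁.clvf_eq_zero_iff γ hℓ₁, S₂.clvf_eq_zero_iff γ hℓ₂,
    proj_eq_zero_iff]

theorem isCompact_levelSet [FiniteDimensional ℝ X₁] [FiniteDimensional ℝ X₂]
    [FiniteDimensional ℝ Xc] [OpensMeasurableSpace (C₁ × Cc)] [SecondCountableTopology (C₁ × Cc)]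
    [OpensMeasurableSpace (C₂ × Cc)] [SecondCountableTopology (C₂ × Cc)] {γ : ℝ} (hγ : 0 ≤ γ)
    {ℓ₁ : Seminorm ℝ (X₁ × Xc)} {ℓ₂ : Seminorm ℝ (X₂ × Xc)}
    (hℓ₁ : ∀ z, ℓ₁ z = 0 → z = 0) (hℓ₂ : ∀ z, ℓ₂ z = 0 → z = 0) (c : ℝ≥0) :
    IsCompact (levelSet S₁ S₂ γ ℓ₁ ℓ₂ c) := by
  have : ProperSpace (X₁ × X₂ × Xc) := FiniteDimensional.proper ℝ _
  have hlsc : LowerSemicontinuous (reconstructed S₁ S₂ γ ℓ₁ ℓ₂) :=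
    LowerSemicontinuous.add
      (LowerSemicontinuous.comp (f := S₁.clvf γ ℓ₁) (g := proj₁)
        (S₁.lowerSemicontinuous_clvf hγ ℓ₁) lipschitzWith_proj₁.continuous)
      (LowerSemicontinuous.comp (f := S₂.clvf γ ℓ₂) (g := proj₂)
        (S₂.lowerSemicontinuous_clvf hγ ℓ₂) lipschitzWith_proj₂.continuous)
  obtain ⟨B₁, hB₁, h₁⟩ := ℓ₁.exists_pos_norm_le_mul hℓ₁
  obtain ⟨B₂, hB₂, h₂⟩ := ℓ₂.exists_pos_norm_le_mul hℓ₂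
  refine Metric.isCompact_of_isClosed_isBounded (hlsc.isClosed_preimage c)
    (isBounded_iff_forall_norm_le.2 ⟨max (B₁ * c) (B₂ * c), fun x hx => ?_⟩)
  have hx' : S₁.clvf γ ℓ₁ (proj₁ x) + S₂.clvf γ ℓ₂ (proj₂ x) ≤ c := hx
  have hb₁ : ℓ₁ (proj₁ x) ≤ c := by
    have := (S₁.ofReal_seminorm_le_clvf γ ℓ₁ _).trans (le_self_add.trans hx')
    rw [← ENNReal.ofReal_coe_nnreal] at this
    exact (ENNReal.ofReal_le_ofReal_iff c.2).1 this
  have hb₂ : ℓ₂ (proj₂ x) ≤ c := by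
    have := (S₂.ofReal_seminorm_le_clvf γ ℓ₂ _).trans (le_add_self.trans hx')
    rw [← ENNReal.ofReal_coe_nnreal] at this
    exact (ENNReal.ofReal_le_ofReal_iff c.2).1 this
  -- The product carries the sup norm, and the two projections together see all three blocks.
  have hn : ‖x‖ ≤ max ‖proj₁ x‖ ‖proj₂ x‖ :=
    max_le ((norm_fst_le (proj₁ x)).trans (le_max_left _ _)) (le_max_right _ _)
  exact hn.trans (max_le_max ((h₁ _).trans (by gcongr)) ((h₂ _).trans (by gcongr)))

theorem clvf_ne_top_of_reconstructed_ne_top {γ : ℝ} {ℓ₁ : Seminorm ℝ (X₁ × Xc)}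
    {ℓ₂ : Seminorm ℝ (X₂ × Xc)} {x : X₁ × X₂ × Xc} (h : reconstructed S₁ S₂ γ ℓ₁ ℓ₂ x ≠ ⊤) :
    S₁.clvf γ ℓ₁ (proj₁ x) ≠ ⊤ ∧ S₂.clvf γ ℓ₂ (proj₂ x) ≠ ⊤ :=
  ENNReal.add_ne_top.1 h

theorem locallyLipschitzOn_reconstructed {γ : ℝ} {ℓ₁ : Seminorm ℝ (X₁ × Xc)}
    {ℓ₂ : Seminorm ℝ (X₂ × Xc)}
    (hV₁ : LocallyLipschitzOn (S₁.domain γ ℓ₁) (fun z => (S₁.clvf γ ℓ₁ z).toReal))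
    (hV₂ : LocallyLipschitzOn (S₂.domain γ ℓ₂) (fun z => (S₂.clvf γ ℓ₂ z).toReal)) :
    LocallyLipschitzOn {x | reconstructed S₁ S₂ γ ℓ₁ ℓ₂ x ≠ ⊤}
      (fun x => (reconstructed S₁ S₂ γ ℓ₁ ℓ₂ x).toReal) := by
  intro x hx
  have hm₁ : MapsTo proj₁ {x | reconstructed S₁ S₂ γ ℓ₁ ℓ₂ x ≠ ⊤} (S₁.domain γ ℓ₁) :=
    fun y hy => (clvf_ne_top_of_reconstructed_ne_top S₁ S₂ hy).1
  have hm₂ : MapsTo proj₂ {x | reconstructed S₁ S₂ γ ℓ₁ ℓ₂ x ≠ ⊤} (S₂.domain γ ℓ₂) :=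
    fun y hy => (clvf_ne_top_of_reconstructed_ne_top S₁ S₂ hy).2
  obtain ⟨K₁, t₁, ht₁, hK₁⟩ := hV₁ (hm₁ hx)
  obtain ⟨K₂, t₂, ht₂, hK₂⟩ := hV₂ (hm₂ hx)
  have hs₁ := (lipschitzWith_proj₁.continuous.continuousWithinAt.tendsto_nhdsWithin hm₁) ht₁
  have hs₂ := (lipschitzWith_proj₂.continuous.continuousWithinAt.tendsto_nhdsWithin hm₂) ht₂
  have hL := ((hK₁.comp lipschitzWith_proj₁.lipschitzOnWith (mapsTo_preimage _ _)).mono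
      inter_subset_left).add
    ((hK₂.comp lipschitzWith_proj₂.lipschitzOnWith (mapsTo_preimage _ _)).mono inter_subset_right)
  -- The neighbourhood is cut down to finite values, where `toReal` is additive.
  refine ⟨_, _, inter_mem (inter_mem hs₁ hs₂) self_mem_nhdsWithin,
    fun y hy z hz => le_of_eq_of_le ?_ (hL hy.1 hz.1)⟩
  obtain ⟨hy₁, hy₂⟩ := clvf_ne_top_of_reconstructed_ne_top S₁ S₂ hy.2
  obtain ⟨hz₁, hz₂⟩ := clvf_ne_top_of_reconstructed_ne_top S₁ S₂ hz.2
  simp only [reconstructed, ENNReal.toReal_add hy₁ hy₂, ENNReal.toReal_add hz₁ hz₂,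
    Function.comp_apply]

/-- A common shared component `uc` is exactly what allows two admissible subsystem controls to be
glued into one control of the full system. -/
theorem exists_mem_reconstructedACS (hS : IsSCSD S S₁ S₂) {γ : ℝ} {ℓ₁ : Seminorm ℝ (X₁ × Xc)}
    {ℓ₂ : Seminorm ℝ (X₂ × Xc)} {x : X₁ × X₂ × Xc}
    (hx : (reconstructedSharedACS S₁ S₂ γ ℓ₁ ℓ₂ x).Nonempty) :
    ∃ u ∈ reconstructedACS S S₁ S₂ γ ℓ₁ ℓ₂ x,
      upperDini (reconstructed S₁ S₂ γ ℓ₁ ℓ₂) x (S.field x u) ≤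
        ((-γ * (reconstructed S₁ S₂ γ ℓ₁ ℓ₂ x).toReal : ℝ) : EReal) := by
  obtain ⟨uc, ⟨v₁, hv₁, hc₁⟩, ⟨v₂, hv₂, hc₂⟩⟩ := hx
  obtain ⟨u₁, hu₁⟩ : ∃ u₁, (u₁, uc) ∈ S₁.acs γ ℓ₁ (proj₁ x) := ⟨v₁.1, by rwa [← hc₁]⟩
  obtain ⟨u₂, hu₂⟩ : ∃ u₂, (u₂, uc) ∈ S₂.acs γ ℓ₂ (proj₂ x) := ⟨v₂.1, by rwa [← hc₂]⟩
  have hu : (u₁, u₂, uc) ∈ S.controls := (hS.mem_controls_iff _).2 ⟨hu₁.1, hu₂.1⟩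
  refine ⟨(u₁, u₂, uc), ⟨hu, hu₁, hu₂⟩, ?_⟩
  have h₁ : upperDini (S₁.clvf γ ℓ₁) (proj₁ x) (proj₁ (S.field x (u₁, u₂, uc)))
      ≤ ((-γ * (S₁.clvf γ ℓ₁ (proj₁ x)).toReal : ℝ) : EReal) := by
    rw [hS.proj₁_field x _ hu]; exact hu₁.2.2
  have h₂ : upperDini (S₂.clvf γ ℓ₂) (proj₂ x) (proj₂ (S.field x (u₁, u₂, uc)))
      ≤ ((-γ * (S₂.clvf γ ℓ₂ (proj₂ x)).toReal : ℝ) : EReal) := by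
    rw [hS.proj₂_field x _ hu]; exact hu₂.2.2
  have hval : -γ * (reconstructed S₁ S₂ γ ℓ₁ ℓ₂ x).toReal
      = -γ * (S₁.clvf γ ℓ₁ (proj₁ x)).toReal + -γ * (S₂.clvf γ ℓ₂ (proj₂ x)).toReal := by
    rw [reconstructed, ENNReal.toReal_add hu₁.2.1 hu₂.2.1, mul_add]
  rw [hval]
  exact upperDini_add_le (fun _ => rfl) (fun _ => rfl) hu₁.2.1 h₁ h₂

theorem levelSet_mem_nhds_zero {γ : ℝ} {ℓ₁ : Seminorm ℝ (X₁ × Xc)} {ℓ₂ : Seminorm ℝ (X₂ × Xc)}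
    (hV₁ : LocallyLipschitzOn (S₁.domain γ ℓ₁) (fun z => (S₁.clvf γ ℓ₁ z).toReal))
    (hV₂ : LocallyLipschitzOn (S₂.domain γ ℓ₂) (fun z => (S₂.clvf γ ℓ₂ z).toReal))
    (hD₁ : S₁.domain γ ℓ₁ ∈ 𝓝 0) (hD₂ : S₂.domain γ ℓ₂ ∈ 𝓝 0) {c : ℝ≥0} (hc : 0 < c) :
    levelSet S₁ S₂ γ ℓ₁ ℓ₂ c ∈ 𝓝 0 := by
  have h₁ : ContinuousAt (fun x : X₁ × X₂ × Xc => S₁.clvf γ ℓ₁ (proj₁ x)) 0 :=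
    ContinuousAt.comp (g := S₁.clvf γ ℓ₁) (f := proj₁) (x := 0) (S₁.continuousAt_clvf_zero hV₁ hD₁)
      lipschitzWith_proj₁.continuous.continuousAt
  have h₂ : ContinuousAt (fun x : X₁ × X₂ × Xc => S₂.clvf γ ℓ₂ (proj₂ x)) 0 :=
    ContinuousAt.comp (g := S₂.clvf γ ℓ₂) (f := proj₂) (x := 0) (S₂.continuousAt_clvf_zero hV₂ hD₂)
      lipschitzWith_proj₂.continuous.continuousAt
  have h : ContinuousAt (reconstructed S₁ S₂ γ ℓ₁ ℓ₂) 0 := h₁.add h₂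
  refine h (Iic_mem_nhds ?_)
  rw [reconstructed_zero]
  exact_mod_cast hc

end Decomposition

end

/-! ### The main theorem -/

theorem theorem2 {n₁ n₂ n_c m₁ m₂ m_c : ℕ}
    (S : ControlSystem
      (EuclideanSpace ℝ (Fin n₁) × EuclideanSpace ℝ (Fin n₂) × EuclideanSpace ℝ (Fin n_c))
      (EuclideanSpace ℝ (Fin m₁) × EuclideanSpace ℝ (Fin m₂) × EuclideanSpace ℝ (Fin m_c)))
    (S₁ : ControlSystem (EuclideanSpace ℝ (Fin n₁) × EuclideanSpace ℝ (Fin n_c))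
      (EuclideanSpace ℝ (Fin m₁) × EuclideanSpace ℝ (Fin m_c)))
    (S₂ : ControlSystem (EuclideanSpace ℝ (Fin n₂) × EuclideanSpace ℝ (Fin n_c))
      (EuclideanSpace ℝ (Fin m₂) × EuclideanSpace ℝ (Fin m_c)))
    (hS : IsSCSD S S₁ S₂)
    (γ : ℝ) (hγ : 0 < γ)
    -- the losses are vector norms
    (ℓ₁ : Seminorm ℝ (EuclideanSpace ℝ (Fin n₁) × EuclideanSpace ℝ (Fin n_c)))
    (hℓ₁ : ∀ z, ℓ₁ z = 0 → z = 0)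
    (ℓ₂ : Seminorm ℝ (EuclideanSpace ℝ (Fin n₂) × EuclideanSpace ℝ (Fin n_c)))
    (hℓ₂ : ∀ z, ℓ₂ z = 0 → z = 0)
    -- the CLVFs of the subsystems are locally Lipschitz on their domains
    (hV₁ : LocallyLipschitzOn (S₁.domain γ ℓ₁) (fun z => (S₁.clvf γ ℓ₁ z).toReal))
    (hV₂ : LocallyLipschitzOn (S₂.domain γ ℓ₂) (fun z => (S₂.clvf γ ℓ₂ z).toReal))
    (c : ℝ≥0)
    (hACS : ∀ x ∈ levelSet S₁ S₂ γ ℓ₁ ℓ₂ c, (reconstructedSharedACS S₁ S₂ γ ℓ₁ ℓ₂ x).Nonempty) :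
    S.IsLipschitzLocalCLF (reconstructed S₁ S₂ γ ℓ₁ ℓ₂) (levelSet S₁ S₂ γ ℓ₁ ℓ₂ c) ∧
    (∀ x ∈ levelSet S₁ S₂ γ ℓ₁ ℓ₂ c, ∃ u ∈ reconstructedACS S S₁ S₂ γ ℓ₁ ℓ₂ x,
      upperDini (reconstructed S₁ S₂ γ ℓ₁ ℓ₂) x (S.field x u) ≤
        ((-γ * (reconstructed S₁ S₂ γ ℓ₁ ℓ₂ x).toReal : ℝ) : EReal)) ∧
    (0 < c → S₁.domain γ ℓ₁ ∈ 𝓝 0 → S₂.domain γ ℓ₂ ∈ 𝓝 0 →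
      levelSet S₁ S₂ γ ℓ₁ ℓ₂ c ∈ 𝓝 0) := by
  have hfin : ∀ x ∈ levelSet S₁ S₂ γ ℓ₁ ℓ₂ c, reconstructed S₁ S₂ γ ℓ₁ ℓ₂ x ≠ ⊤ :=
    fun x hx => ne_top_of_le_ne_top ENNReal.coe_ne_top hx
  have hcompact := fun c => isCompact_levelSet S₁ S₂ hγ.le hℓ₁ hℓ₂ c
  have hpos : ∀ x, x ≠ 0 → 0 < reconstructed S₁ S₂ γ ℓ₁ ℓ₂ x := fun x hx =>
    pos_iff_ne_zero.2 (mt (reconstructed_eq_zero_iff S₁ S₂ γ hℓ₁ hℓ₂).1 hx)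
  refine ⟨⟨hfin, ?_, ?_, reconstructed_zero S₁ S₂ γ ℓ₁ ℓ₂, fun x _ => hpos x, fun c' => ?_,
    fun x hx hx0 => ?_⟩, fun x hx => exists_mem_reconstructedACS S₁ S₂ hS (hACS x hx),
    fun hc hD₁ hD₂ => levelSet_mem_nhds_zero S₁ S₂ hV₁ hV₂ hD₁ hD₂ hc⟩
  · exact ((locallyLipschitzOn_reconstructed S₁ S₂ hV₁ hV₂).mono
      hfin).exists_lipschitzOnWith_of_compact (hcompact c)
  · simp [levelSet, reconstructed_zero]
  -- A sublevel set inside the level set is the intersection of two compact level sets.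
  · exact (hcompact c).inter (hcompact c')
  · obtain ⟨u, hu, hle⟩ := exists_mem_reconstructedACS S₁ S₂ hS (hACS x hx)
    refine ⟨u, hu.1, hle.trans_lt ?_⟩
    have := ENNReal.toReal_pos (hpos x hx0).ne' (hfin x hx)
    exact_mod_cast (by nlinarith : -γ * (reconstructed S₁ S₂ γ ℓ₁ ℓ₂ x).toReal < 0)
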